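/- For a vector $\mathbf v\in\mathbb Z_4^n$, its type is $(t_0,t_1,t_2,t_3)$, where $t_k$ is the number of coordinates of $\mathbf v$ equal to $k$. Let $r,s$ be integers with $r\ge s\ge 1$ and $r$ even, and put $n=2(r+s)$. Let $S\subset\mathbb Z_4^n$ be the set of all vectors of type $(r,s,r,s)$, and let $G(r,s)=\mathrm{Cay}(\mathbb Z_4^n,S)$ be the graph with vertex set $\mathbb Z_4^n$ in which $\mathbf v,\mathbf w$ are adjacent if and only if $\mathbf v-\mathbf w\in S$. For $\mathbf v\in\mathbb Z_4^n$ let $$\lambda(\mathbf v)=\sum_{\mathbf x\in S} i^{\,\mathbf v\cdot\mathbf x},$$ and write $\lambda(t_0,t_1,t_2,t_3)$ for the value of $\lambda(\mathbf v)$ at vectors $\mathbf v$ of type $(t_0,t_1,t_2,t_3)$ (it depends only on the type). Then the smallest eigenvalue of (the adjacency matrix of) $G(r,s)$ is $$\lambda_{\min}(G(r,s))=\lambda(0,1,n-2,1)=-\frac{1}{n-1}\binom{n}{r,s,r,s},\qquad \binom{n}{r,s,r,s}=\frac{n!}{(r!)^2(s!)^2},$$ in each of the following two regimes: (R1) $s\ge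 2$ is fixed and $n$ is large enough, that is, for every integer $s\ge2$ there is $N=N(s)$ such that the formula holds for all even $r\ge s$ with $n=2(r+s)\ge N$; (R2) $s=\alpha n/2$ with $0<\alpha\le 0.17$ fixed and $n$ is large enough, that is, for every real $\alpha$ with $0<\alpha\le0.17$ there is $N=N(\alpha)$ such that the formula holds for all $r\ge s$ with $r$ even, $n=2(r+s)\ge N$ and $s=\alpha n/2$. -/

import Mathlib

/-- The `k`-th Hamming weight of `v ∈ ℤ_p^n`: the number of coordinates of `v` equal to `k`. -/
def hammingWt {p n : ℕ} (k : ZMod p) (v : Fin n → ZMod p) : ℕ :=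
  (Finset.univ.filter fun i => v i = k).card

/-- The set `ℤ_p(t)` of vectors of type `t = (t_0, …, t_{p-1})` in `ℤ_p^n`: each symbol `k` occurs
exactly `t_k` times. -/
def vectorsOfType (p n : ℕ) (t : Fin p → ℕ) : Set (Fin n → ZMod p) :=
  {v | ∀ k : Fin p, hammingWt ((k : ℕ) : ZMod p) v = t k}

/-- The Cayley graph `Cay(ℤ_p^n, t)` generated by the vectors of type `t`. -/
def typeCayley (p n : ℕ) (t : Fin p → ℕ) : SimpleGraph (Fin n → ZMod p) :=
  SimpleGraph.addCayley (vectorsOfType p n t)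

open Classical in
/-- The character sum `λ(v) = ∑_{x ∈ ℤ_p(t)} ζ_p^{v · x}` with `ζ_p = exp(2πi/p)`. -/
noncomputable def charSum (p n : ℕ) [NeZero p] (t : Fin p → ℕ) (v : Fin n → ZMod p) : ℂ :=
  ∑ x ∈ Finset.univ.filter (fun x => x ∈ vectorsOfType p n t), ZMod.stdAddChar (v ⬝ᵥ x)

open Classical in
/-- The eigenvalues of a finite graph, i.e. of its adjacency matrix over `ℝ`. -/
def graphEigenvalues {V : Type*} [Fintype V] (G : SimpleGraph V) : Set ℝ :=
  {μ | Module.End.HasEigenvalue (Matrix.mulVecLin (G.adjMatrix ℝ)) μ}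

/-!
The eigenvalues of the Cayley graph are the character sums `λ(v)`. As `r` is even, `λ` does not
change when a constant vector is added to `v`, so one may assume that at most half of the entries
of `v` are odd.

Write each `x ∈ S` as `2 b + c` with `b` and `c` zero-one vectors. The factor `(-1) ^ (v · b)` of
`i ^ (v · x)` is a product of signs over the odd entries of `v`, and the signs `(-1) ^ (b_j)` are
exchangeable on the support of `c` and on its complement, with sum zero on each. A sum of products
of exchangeable signs is given by the three-term recurrence of the Krawtchouk polynomials. At the
centre `z = 0` their values in degree `d` have a sign depending on `d` only, so the triangle
inequality over `c` loses nothing, and they are at most `1 / (n - 1)` for `1 ≤ d ≤ n / 2`. This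
settles every `v` with an odd entry.

If all entries of `v` are even, averaging over permutations exchanges the roles of `v` and `x`:
`λ(v) / |S|` is a normalised Krawtchouk value of degree `2 s`, to be bounded below by
`-1 / (n - 1)`. Outside the oscillatory region `z ^ 2 ≤ 8 s (n - 2 s)` it is positive, and inside
the recurrence bounds it geometrically. The minimum is attained at `e_a - e_b`, which differs from a
vector of type `(0, 1, n - 2, 1)` by the constant vector `2`.
-/

section Krawtchouk

/-- The normalised Krawtchouk values `K_d(t) / C(n, d)` at `n - 2 t = z`: the average of the
products `∏_{i ∈ D} ε i` over the `d`-subsets `D` of `n` signs `ε i` with sum `z`. They are encoded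
by their three-term recurrence, which makes sense for all real `n` and `z`; the division is by zero
only from degree `n + 1` on. -/
noncomputable def normalizedKrawtchouk (n z : ℝ) : ℕ → ℝ
  | 0 => 1
  | 1 => z / n
  | d + 2 => (z * normalizedKrawtchouk n z (d + 1) - (d + 1) * normalizedKrawtchouk n z d) /
      (n - (d + 1))

variable {n z : ℝ} {d : ℕ}

@[simp]
lemma normalizedKrawtchouk_zero (n z : ℝ) : normalizedKrawtchouk n z 0 = 1 := by
  rw [normalizedKrawtchouk]

lemma normalizedKrawtchouk_one (n z : ℝ) : normalizedKrawtchouk n z 1 = z / n := by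
  rw [normalizedKrawtchouk]

lemma normalizedKrawtchouk_add_two (n z : ℝ) (d : ℕ) :
    normalizedKrawtchouk n z (d + 2) =
      (z * normalizedKrawtchouk n z (d + 1) - (d + 1) * normalizedKrawtchouk n z d) /
        (n - (d + 1)) := by
  rw [normalizedKrawtchouk]

lemma normalizedKrawtchouk_neg (n z : ℝ) (d : ℕ) :
    normalizedKrawtchouk n (-z) d = (-1) ^ d * normalizedKrawtchouk n z d := by
  induction d using Nat.twoStepInduction with
  | zero => simp
  | one => simp [normalizedKrawtchouk_one, neg_div]
  | more d ih₀ ih₁ =>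
    rw [normalizedKrawtchouk_add_two, normalizedKrawtchouk_add_two, ih₀, ih₁]
    ring

lemma normalizedKrawtchouk_at_zero_of_odd (n : ℝ) (hd : Odd d) :
    normalizedKrawtchouk n 0 d = 0 := by
  have h := normalizedKrawtchouk_neg n 0 d
  rw [neg_zero, hd.neg_one_pow] at h
  linarith

lemma normalizedKrawtchouk_at_zero_two_mul_succ (n : ℝ) (m : ℕ) :
    normalizedKrawtchouk n 0 (2 * (m + 1)) =
      -((2 * m + 1) / (n - (2 * m + 1)) * normalizedKrawtchouk n 0 (2 * m)) := by
  rw [Nat.mul_succ, normalizedKrawtchouk_add_two]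
  push_cast
  ring

lemma neg_one_pow_mul_normalizedKrawtchouk_at_zero_nonneg {m : ℕ} (h : 2 * m ≤ n) :
    0 ≤ (-1) ^ m * normalizedKrawtchouk n 0 (2 * m) := by
  induction m with
  | zero => simp
  | succ m ih =>
    push_cast at h
    rw [normalizedKrawtchouk_at_zero_two_mul_succ, pow_succ]
    have hquot : (0 : ℝ) ≤ (2 * m + 1) / (n - (2 * m + 1)) :=
      div_nonneg (by positivity) (by linarith)
    linarith [mul_nonneg hquot (ih (by linarith))]

lemma abs_normalizedKrawtchouk_at_zero_le {m : ℕ} (hm : 1 ≤ m) (h : 4 * m ≤ n) :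
    |normalizedKrawtchouk n 0 (2 * m)| ≤ 1 / (n - 1) := by
  induction m, hm using Nat.le_induction with
  | base =>
    have hn : 0 ≤ n - 1 := by norm_num at h; linarith
    rw [normalizedKrawtchouk_at_zero_two_mul_succ n 0]
    simp [abs_of_nonneg hn]
  | succ m hm ih =>
    push_cast at h
    have hquot : |(2 * m + 1) / (n - (2 * m + 1))| ≤ 1 := by
      rw [abs_of_nonneg (div_nonneg (by positivity) (by linarith))]
      exact div_le_one_of_le₀ (by linarith) (by linarith)
    rw [normalizedKrawtchouk_at_zero_two_mul_succ, abs_neg, abs_mul]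
    exact (mul_le_of_le_one_left (abs_nonneg _) hquot).trans (ih (by linarith))

lemma neg_one_pow_div_two_mul_normalizedKrawtchouk_at_zero_nonneg (h : d ≤ n) :
    0 ≤ (-1) ^ (d / 2) * normalizedKrawtchouk n 0 d := by
  rcases Nat.even_or_odd' d with ⟨m, rfl | rfl⟩
  · rw [Nat.mul_div_cancel_left m two_pos]
    exact neg_one_pow_mul_normalizedKrawtchouk_at_zero_nonneg (by exact_mod_cast h)
  · simp [normalizedKrawtchouk_at_zero_of_odd n (odd_two_mul_add_one m)]

lemma neg_one_pow_div_two_mul_normalizedKrawtchouk_at_zero_mul_nonneg {p q : ℝ} {a b : ℕ}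
    (ha : a ≤ p) (hb : b ≤ q) :
    0 ≤ (-1) ^ ((a + b) / 2) * (normalizedKrawtchouk p 0 a * normalizedKrawtchouk q 0 b) := by
  rcases Nat.even_or_odd a with hae | hao
  · have h := mul_nonneg (neg_one_pow_div_two_mul_normalizedKrawtchouk_at_zero_nonneg ha)
      (neg_one_pow_div_two_mul_normalizedKrawtchouk_at_zero_nonneg hb)
    rw [Nat.add_div_of_dvd_right hae.two_dvd, pow_add]
    exact h.trans_eq (by ring)
  · simp [normalizedKrawtchouk_at_zero_of_odd _ hao]

lemma abs_normalizedKrawtchouk_at_zero_le_of_two_mul_le (hd : 1 ≤ d) (h : 2 * d ≤ n) :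
    |normalizedKrawtchouk n 0 d| ≤ 1 / (n - 1) := by
  rcases Nat.even_or_odd' d with ⟨m, rfl | rfl⟩
  · exact abs_normalizedKrawtchouk_at_zero_le (by omega) (by push_cast at h; linarith)
  · have hd' : (1 : ℝ) ≤ (2 * m + 1 : ℕ) := by exact_mod_cast hd
    rw [normalizedKrawtchouk_at_zero_of_odd n (odd_two_mul_add_one m), abs_zero]
    exact one_div_nonneg.2 (by linarith)

lemma normalizedKrawtchouk_step_bound (hz : 0 < z) (hdn : d + 1 ≤ n)
    (h : ∀ j : ℕ, 1 ≤ j → j ≤ d → 4 * j * (n - j + 1) ≤ z ^ 2) :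
    0 < normalizedKrawtchouk n z d ∧
      z * normalizedKrawtchouk n z d ≤ 2 * (n - d) * normalizedKrawtchouk n z (d + 1) := by
  induction d with
  | zero =>
    have hn : n ≠ 0 := by norm_num at hdn; linarith
    rw [zero_add, normalizedKrawtchouk_zero, normalizedKrawtchouk_one, Nat.cast_zero, sub_zero,
      mul_assoc, mul_div_cancel₀ _ hn]
    exact ⟨one_pos, by linarith⟩
  | succ d ih =>
    push_cast at hdn
    obtain ⟨hpos, hstep⟩ := ih (by linarith) fun j hj hjd => h j hj (by omega)
    have hpos' : 0 < normalizedKrawtchouk n z (d + 1) :=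
      pos_of_mul_pos_right ((mul_pos hz hpos).trans_le hstep) (by linarith)
    refine ⟨hpos', ?_⟩
    have hsq := h (d + 1) (by omega) le_rfl
    push_cast at hsq ⊢
    have hlast : z * ((d + 1) * normalizedKrawtchouk n z d) ≤
        z * (z / 2 * normalizedKrawtchouk n z (d + 1)) :=
      calc z * ((d + 1) * normalizedKrawtchouk n z d)
          = (d + 1) * (z * normalizedKrawtchouk n z d) := by ring
        _ ≤ (d + 1) * (2 * (n - d) * normalizedKrawtchouk n z (d + 1)) := by gcongr
        _ = 4 * (d + 1) * (n - (d + 1) + 1) / 2 * normalizedKrawtchouk n z (d + 1) := by ring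
        _ ≤ z ^ 2 / 2 * normalizedKrawtchouk n z (d + 1) := by gcongr
        _ = z * (z / 2 * normalizedKrawtchouk n z (d + 1)) := by ring
    rw [normalizedKrawtchouk_add_two, mul_assoc, mul_div_cancel₀ _ (by linarith)]
    linarith [le_of_mul_le_mul_left hlast hz]

lemma normalizedKrawtchouk_pos (hz : 0 < z) (hdn : 3 * d ≤ n) (h : 4 * d * (n - d) ≤ z ^ 2) :
    0 < normalizedKrawtchouk n z d := by
  cases d with
  | zero => simp
  | succ d =>
    push_cast at hdn h
    obtain ⟨hpos, hstep⟩ := normalizedKrawtchouk_step_bound (d := d) (n := n) hz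
      (by linarith [d.cast_nonneg (α := ℝ)]) fun j _ hjd => by
        have hjd' : (j : ℝ) ≤ d := by exact_mod_cast hjd
        nlinarith [mul_nonneg (sub_nonneg.2 hjd') (by linarith : (0 : ℝ) ≤ n + 1 - d - j)]
    exact pos_of_mul_pos_right ((mul_pos hz hpos).trans_le hstep)
      (by linarith [d.cast_nonneg (α := ℝ)])

lemma neg_le_normalizedKrawtchouk {B : ℝ} (hB : 0 ≤ B) (hd : Even d)
    (hdn : 3 * d ≤ n)
    (h : ∀ z, 0 ≤ z → z ^ 2 ≤ 4 * d * (n - d) → |normalizedKrawtchouk n z d| ≤ B) (z : ℝ) :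
    -B ≤ normalizedKrawtchouk n z d := by
  wlog hz : 0 ≤ z generalizing z
  · have hneg := this (-z) (by linarith)
    rwa [normalizedKrawtchouk_neg, hd.neg_one_pow, one_mul] at hneg
  rcases le_or_gt (z ^ 2) (4 * d * (n - d)) with hosc | hosc
  · exact (abs_le.1 (h z hz hosc)).1
  · have hz0 : z ≠ 0 := by
      rintro rfl
      have hd' : (0 : ℝ) ≤ d := d.cast_nonneg
      nlinarith [mul_nonneg hd' (by linarith : 0 ≤ n - d)]
    linarith [normalizedKrawtchouk_pos (hz.lt_of_ne' hz0) hdn hosc.le]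

lemma abs_normalizedKrawtchouk_le_mul_pow {θ B : ℝ} {a b : ℕ} (hz : 0 ≤ z) (hB : 0 ≤ B)
    (hθ : 0 ≤ θ) (hb : z * θ + b ≤ (n - b) * θ ^ 2) (h₀ : |normalizedKrawtchouk n z a| ≤ B)
    (h₁ : |normalizedKrawtchouk n z (a + 1)| ≤ B * θ) {i : ℕ} (hi : a + i ≤ b) :
    |normalizedKrawtchouk n z (a + i)| ≤ B * θ ^ i := by
  induction i using Nat.twoStepInduction with
  | zero => simpa using h₀
  | one => simpa using h₁
  | more i ih₀ ih₁ =>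
    set k : ℝ := (a + i : ℕ) + 1
    have hk : 0 < k := by positivity
    have hkb : k ≤ b := by simp only [k]; exact_mod_cast (by omega : a + i + 1 ≤ b)
    have hkn : 0 < n - k :=
      (pos_of_mul_pos_left (by nlinarith [mul_nonneg hz hθ]) (sq_nonneg θ)).trans_le
        (by linarith : n - b ≤ n - k)
    have hstep : z * θ + k ≤ (n - k) * θ ^ 2 := by nlinarith [sq_nonneg θ]
    rw [show a + (i + 2) = a + i + 2 by ring, normalizedKrawtchouk_add_two, abs_div,
      abs_of_pos hkn, div_le_iff₀ hkn]
    calc |z * normalizedKrawtchouk n z (a + i + 1) - k * normalizedKrawtchouk n z (a + i)|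
        ≤ z * |normalizedKrawtchouk n z (a + i + 1)| + k * |normalizedKrawtchouk n z (a + i)| := by
          simpa only [abs_mul, abs_of_nonneg hz, abs_of_pos hk] using abs_sub
            (z * normalizedKrawtchouk n z (a + i + 1)) (k * normalizedKrawtchouk n z (a + i))
      _ ≤ z * (B * θ ^ (i + 1)) + k * (B * θ ^ i) := by
          gcongr
          exacts [ih₁ (by omega), ih₀ (by omega)]
      _ = B * θ ^ i * (z * θ + k) := by ring
      _ ≤ B * θ ^ i * ((n - k) * θ ^ 2) := by gcongr
      _ = B * θ ^ (i + 2) * (n - k) := by ring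

lemma abs_normalizedKrawtchouk_le_pow {θ : ℝ} {b : ℕ} (hz : 0 ≤ z) (hθ : 0 < θ)
    (hb : z * θ + b ≤ (n - b) * θ ^ 2) (hd : d ≤ b) : |normalizedKrawtchouk n z d| ≤ θ ^ d := by
  have hn : 0 ≤ n - b :=
    nonneg_of_mul_nonneg_left ((by positivity : 0 ≤ z * θ + b).trans hb) (by positivity)
  have hzn : z ≤ n * θ := by
    refine le_of_mul_le_mul_right ?_ hθ
    nlinarith [b.cast_nonneg (α := ℝ), sq_nonneg θ]
  have hone : |normalizedKrawtchouk n z 1| ≤ θ := by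
    have hn0 : 0 ≤ n := by linarith [b.cast_nonneg (α := ℝ)]
    rw [normalizedKrawtchouk_one, abs_of_nonneg (div_nonneg hz hn0)]
    exact div_le_of_le_mul₀ hn0 hθ.le (by linarith)
  simpa using abs_normalizedKrawtchouk_le_mul_pow (a := 0) (i := d) hz zero_le_one hθ.le hb
    (by simp) (by simpa using hone) (by simpa using hd)

end Krawtchouk

section KrawtchoukLowerBound

variable {n s m d : ℕ} {z : ℝ}

lemma add_two_sq_le_four_mul_three_pow (k : ℕ) : ((k : ℝ) + 2) ^ 2 ≤ 4 * 3 ^ k := by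
  induction k with
  | zero => norm_num
  | succ k ih =>
    push_cast
    calc ((k : ℝ) + 1 + 2) ^ 2 ≤ 3 * (k + 2) ^ 2 := by nlinarith [k.cast_nonneg (α := ℝ)]
      _ ≤ 3 * (4 * 3 ^ k) := by gcongr
      _ = 4 * 3 ^ (k + 1) := by ring

lemma mul_div_pow_le_sq {x : ℝ} (hs : 2 ≤ s) (hx : 0 ≤ x) (hsx : s * x ≤ 1 / 3) :
    (s * x) ^ s ≤ (2 * x) ^ 2 := by
  obtain ⟨k, rfl⟩ := Nat.exists_eq_add_of_le' hs
  have hpow : (((k + 2 : ℕ) : ℝ)) ^ 2 ≤ 4 * 3 ^ k := by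
    exact_mod_cast add_two_sq_le_four_mul_three_pow k
  calc ((k + 2 : ℕ) * x) ^ (k + 2)
      = ((k + 2 : ℕ) * x) ^ k * ((k + 2 : ℕ) ^ 2 * x ^ 2) := by ring
    _ ≤ (1 / 3) ^ k * (4 * 3 ^ k * x ^ 2) := by gcongr
    _ = ((1 / 3) * 3) ^ k * (2 * x) ^ 2 := by rw [mul_pow]; ring
    _ = (2 * x) ^ 2 := by norm_num

lemma abs_normalizedKrawtchouk_two_mul_le_of_small (hs : 2 ≤ s) (hsn : 50 * s ≤ n)
    (hn : 1200 ≤ n) (hz : 0 ≤ z) (hzn : z ^ 2 ≤ 8 * s * n) :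
    |normalizedKrawtchouk n z (2 * s)| ≤ 1 / n := by
  have hs' : (2 : ℝ) ≤ s := by exact_mod_cast hs
  have hsn' : 50 * (s : ℝ) ≤ n := by exact_mod_cast hsn
  have hn' : (1200 : ℝ) ≤ n := by exact_mod_cast hn
  have : (0 : ℝ) < n := by linarith
  set x : ℝ := 50 / (3 * n) with hx
  have hx0 : 0 < x := by positivity
  have hnx : n * x = 50 / 3 := by rw [hx]; field_simp
  set θ : ℝ := √(s * x)
  have hθ : θ ^ 2 = s * x := Real.sq_sqrt (by positivity)
  have hzθ : z * θ ≤ 14 * s := by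
    refine (pow_le_pow_iff_left₀ (by positivity) (by positivity) two_ne_zero).1 ?_
    calc (z * θ) ^ 2 ≤ 8 * s * n * (s * x) := by rw [mul_pow, hθ]; gcongr
      _ = 8 * s ^ 2 * (n * x) := by ring
      _ ≤ (14 * s) ^ 2 := by rw [hnx]; nlinarith
  have hsx : s * x ≤ 1 / 3 := by nlinarith
  have henv : z * θ + (2 * s : ℕ) ≤ (n - (2 * s : ℕ)) * θ ^ 2 := by
    push_cast
    rw [hθ]
    nlinarith
  calc |normalizedKrawtchouk n z (2 * s)|
      ≤ θ ^ (2 * s) :=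
        abs_normalizedKrawtchouk_le_pow hz (Real.sqrt_pos.2 (by positivity)) henv le_rfl
    _ = (s * x) ^ s := by rw [pow_mul, hθ]
    _ ≤ (2 * x) ^ 2 := mul_div_pow_le_sq hs hx0.le hsx
    _ = 10000 / (9 * n) * (1 / n) := by rw [hx]; field_simp; norm_num
    _ ≤ 1 * (1 / n) := by gcongr; rw [div_le_one (by positivity)]; linarith
    _ = 1 / n := one_mul _

/- The envelope ratio `θ` must satisfy `z θ + d ≤ (n - d) θ²`: near the bottom degrees it can be
taken below one, and `1.094` suffices up to degree `0.17 n`; the gain from the first `2 m` degrees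
outweighs the later growth. -/
lemma abs_normalizedKrawtchouk_le_of_le_two_mul (hm : 6 ≤ m) (hmn : 50 * m ≤ n) (hz : 0 ≤ z)
    (hzn : z ≤ 0.7513 * n) (hd : d ≤ 2 * m + 1) : |normalizedKrawtchouk n z d| ≤ 0.84 ^ d := by
  have hm' : (6 : ℝ) ≤ m := by exact_mod_cast hm
  have hmn' : 50 * (m : ℝ) ≤ n := by exact_mod_cast hmn
  refine abs_normalizedKrawtchouk_le_pow hz (by norm_num) ?_ hd
  push_cast
  linarith

lemma abs_normalizedKrawtchouk_le_of_le_six_mul (hm : 6 ≤ m) (hmn : 50 * m ≤ n) (hz : 0 ≤ z)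
    (hzn : z ≤ 0.7513 * n) (hd : 2 * m ≤ d) (hd' : d ≤ 6 * m + 1) :
    |normalizedKrawtchouk n z d| ≤ 0.84 ^ (2 * m) := by
  have hm' : (6 : ℝ) ≤ m := by exact_mod_cast hm
  have hmn' : 50 * (m : ℝ) ≤ n := by exact_mod_cast hmn
  have hstart := abs_normalizedKrawtchouk_le_of_le_two_mul hm hmn hz hzn (Nat.le_succ (2 * m))
  have hnext := abs_normalizedKrawtchouk_le_of_le_two_mul hm hmn hz hzn le_rfl
  obtain ⟨i, rfl⟩ := Nat.exists_eq_add_of_le hd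
  simpa using abs_normalizedKrawtchouk_le_mul_pow (θ := 1) hz (by positivity) zero_le_one
    (by push_cast; linarith) hstart
    (hnext.trans (by
      rw [mul_one]
      exact pow_le_pow_of_le_one (by norm_num) (by norm_num) (Nat.le_succ _))) hd'

lemma abs_normalizedKrawtchouk_le_of_le_mul (hm : 6 ≤ m) (hmn : 50 * m ≤ n) (hz : 0 ≤ z)
    (hzn : z ≤ 0.7513 * n) (hd : 2 * m ≤ d) (hdn : d ≤ (0.17 : ℝ) * n) :
    |normalizedKrawtchouk n z d| ≤ 0.84 ^ (2 * m) * 1.094 ^ (d - 6 * m) := by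
  rcases le_total d (6 * m) with hdm | hdm
  · rw [Nat.sub_eq_zero_of_le hdm, pow_zero, mul_one]
    exact abs_normalizedKrawtchouk_le_of_le_six_mul hm hmn hz hzn hd (hdm.trans (Nat.le_succ _))
  obtain ⟨i, rfl⟩ := Nat.exists_eq_add_of_le hdm
  have hstart := abs_normalizedKrawtchouk_le_of_le_six_mul hm hmn hz hzn (d := 6 * m) (by omega)
    (by omega)
  have hnext := abs_normalizedKrawtchouk_le_of_le_six_mul hm hmn hz hzn (d := 6 * m + 1)
    (by omega) le_rfl
  rw [Nat.add_sub_cancel_left]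
  exact abs_normalizedKrawtchouk_le_mul_pow hz (by positivity) (by norm_num) (by linarith) hstart
    (hnext.trans (le_mul_of_one_le_right (by positivity) (by norm_num))) le_rfl

lemma abs_normalizedKrawtchouk_le_pow_div_fifty (hn : 850 ≤ n) (hz : 0 ≤ z)
    (hzn : z ≤ 0.7513 * n) (hd : n < 25 * d) (hdn : d ≤ (0.17 : ℝ) * n) :
    |normalizedKrawtchouk n z d| ≤ 0.93 ^ (n / 50) := by
  set m := n / 50
  have hdm : 100 * d ≤ 17 * n := by
    have : 100 * (d : ℝ) ≤ 17 * n := by linarith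
    exact_mod_cast this
  calc |normalizedKrawtchouk n z d|
      ≤ 0.84 ^ (2 * m) * 1.094 ^ (d - 6 * m) :=
        abs_normalizedKrawtchouk_le_of_le_mul (by omega) (by omega) hz hzn (by omega) hdn
    _ ≤ 0.84 ^ (2 * m) * 1.094 ^ (3 * m) := by gcongr; exacts [by norm_num, by omega]
    _ = (0.84 ^ 2 * 1.094 ^ 3) ^ m := by rw [pow_mul, pow_mul, mul_pow]
    _ ≤ 0.93 ^ m := by gcongr; norm_num

lemma eventually_pow_div_fifty_le : ∀ᶠ n : ℕ in Filter.atTop, (0.93 : ℝ) ^ (n / 50) ≤ 1 / n := by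
  have hlim : Filter.Tendsto (fun m : ℕ => 100 * ((m : ℝ) * 0.93 ^ m)) Filter.atTop (nhds 0) := by
    simpa using (tendsto_self_mul_const_pow_of_lt_one (r := 0.93) (by norm_num)
      (by norm_num)).const_mul (100 : ℝ)
  have hdiv : Filter.Tendsto (fun n : ℕ => n / 50) Filter.atTop Filter.atTop :=
    Nat.tendsto_div_const_atTop (by norm_num)
  filter_upwards [hdiv.eventually (hlim.eventually (eventually_le_nhds one_pos)),
    Filter.eventually_ge_atTop 50] with n hpow hn
  have hn' : (n : ℝ) ≤ 100 * (n / 50 : ℕ) := by exact_mod_cast (by omega : n ≤ 100 * (n / 50))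
  rw [le_div_iff₀ (by positivity)]
  nlinarith [pow_nonneg (by norm_num : (0 : ℝ) ≤ 0.93) (n / 50)]

lemma eventually_neg_le_normalizedKrawtchouk_two_mul :
    ∀ᶠ n : ℕ in Filter.atTop, ∀ s : ℕ, 2 ≤ s → 2 * s ≤ (0.17 : ℝ) * n → ∀ z : ℝ,
      -(1 / ((n : ℝ) - 1)) ≤ normalizedKrawtchouk n z (2 * s) := by
  filter_upwards [eventually_pow_div_fifty_le, Filter.eventually_ge_atTop 1200]
    with n hpow hn s hs hsn
  have hn' : (1200 : ℝ) ≤ n := by exact_mod_cast hn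
  have hinv : 1 / (n : ℝ) ≤ 1 / (n - 1) := one_div_le_one_div_of_le (by linarith) (by linarith)
  refine neg_le_normalizedKrawtchouk (one_div_nonneg.2 (by linarith)) (even_two_mul s)
    (by push_cast; linarith) fun z hz hosc => le_trans ?_ hinv
  push_cast at hosc
  rcases le_or_gt (50 * s) n with hsmall | hlarge
  · refine abs_normalizedKrawtchouk_two_mul_le_of_small hs hsmall hn hz (hosc.trans ?_)
    nlinarith
  · have hzn : z ≤ 0.7513 * n := by
      refine (pow_le_pow_iff_left₀ hz (by positivity) two_ne_zero).1 ?_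
      nlinarith [mul_nonneg (by linarith : (0 : ℝ) ≤ 0.17 * n - 2 * s)
        (by linarith : (0 : ℝ) ≤ 0.83 * n - 2 * s)]
    exact (abs_normalizedKrawtchouk_le_pow_div_fifty (by omega) hz hzn (by omega)
      (by push_cast; exact hsn)).trans hpow

end KrawtchoukLowerBound

section ExchangeableSigns

variable {ι α : Type*} [DecidableEq ι]

lemma prod_insert_comp_swap {M : Type*} [CommMonoid M] (f : α → M) (x : ι → α) {L : Finset ι}
    {i j : ι} (hi : i ∉ L) (hj : j ∉ L) :
    ∏ l ∈ insert i L, f ((x ∘ Equiv.swap i j) l) = ∏ l ∈ insert j L, f (x l) := by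
  have hfix : ∀ l ∈ L, f ((x ∘ Equiv.swap i j) l) = f (x l) := fun l hl => by
    rw [Function.comp_apply, Equiv.swap_apply_of_ne_of_ne (ne_of_mem_of_not_mem hl hi)
      (ne_of_mem_of_not_mem hl hj)]
  rw [Finset.prod_insert hi, Finset.prod_insert hj, Finset.prod_congr rfl hfix]
  simp

lemma sum_comp_swap {M : Type*} [AddCommMonoid M] {Ω : Finset (ι → α)} {i j : ι}
    (hΩ : ∀ x ∈ Ω, x ∘ Equiv.swap i j ∈ Ω) (f : (ι → α) → M) :
    ∑ x ∈ Ω, f (x ∘ Equiv.swap i j) = ∑ x ∈ Ω, f x := by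
  have hinv : ∀ x : ι → α, (x ∘ Equiv.swap i j) ∘ Equiv.swap i j = x := fun x => by
    ext l
    simp
  exact Finset.sum_nbij' (· ∘ Equiv.swap i j) (· ∘ Equiv.swap i j) hΩ hΩ (fun x _ => hinv x)
    (fun x _ => hinv x) fun _ _ => rfl

variable {Ω : Finset (ι → α)} {w : (ι → α) → ℝ} {ε : α → ℝ} {U : Finset ι} {c : ℝ}

/- Multiply `∏ l ∈ L, ε (x l)` by `c = ∑ j ∈ U, ε (x j)`: an index `j ∉ L` enlarges the product,
and by exchangeability all of these contribute the same sum, while `j ∈ L` cancels a factor. -/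
lemma sum_mul_prod_insert_of_exchangeable (hε : ∀ a, ε a * ε a = 1)
    (hsum : ∀ x ∈ Ω, ∑ j ∈ U, ε (x j) = c)
    (hΩ : ∀ i ∈ U, ∀ j ∈ U, ∀ x ∈ Ω, x ∘ Equiv.swap i j ∈ Ω)
    (hw : ∀ i ∈ U, ∀ j ∈ U, ∀ x, w (x ∘ Equiv.swap i j) = w x)
    {L : Finset ι} (hL : L ⊆ U) {i : ι} (hi : i ∈ U) (hiL : i ∉ L) :
    (U.card - L.card) * ∑ x ∈ Ω, w x * ∏ l ∈ insert i L, ε (x l) =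
      c * (∑ x ∈ Ω, w x * ∏ l ∈ L, ε (x l)) -
        ∑ j ∈ L, ∑ x ∈ Ω, w x * ∏ l ∈ L.erase j, ε (x l) := by
  have hswap : ∀ j ∈ U \ L, ∑ x ∈ Ω, w x * ∏ l ∈ insert j L, ε (x l) =
      ∑ x ∈ Ω, w x * ∏ l ∈ insert i L, ε (x l) := fun j hj => by
    obtain ⟨hjU, hjL⟩ := Finset.mem_sdiff.1 hj
    rw [← sum_comp_swap (hΩ i hi j hjU) fun x => w x * ∏ l ∈ insert i L, ε (x l)]
    simp only [hw i hi j hjU, prod_insert_comp_swap ε _ hiL hjL]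
  have houter : ∑ j ∈ U \ L, ∑ x ∈ Ω, w x * ∏ l ∈ insert j L, ε (x l) =
      (U.card - L.card) * ∑ x ∈ Ω, w x * ∏ l ∈ insert i L, ε (x l) := by
    rw [Finset.sum_congr rfl hswap, Finset.sum_const, Finset.card_sdiff_of_subset hL, nsmul_eq_mul,
      Nat.cast_sub (Finset.card_le_card hL)]
  rw [← houter, eq_sub_iff_add_eq, Finset.sum_comm, Finset.sum_comm (s := L),
    ← Finset.sum_add_distrib, Finset.mul_sum]
  refine Finset.sum_congr rfl fun x hx => ?_
  rw [← hsum x hx, ← Finset.sum_sdiff hL, add_mul, Finset.sum_mul, Finset.sum_mul]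
  congr 1
  · refine Finset.sum_congr rfl fun j hj => ?_
    rw [Finset.prod_insert (Finset.mem_sdiff.1 hj).2]
    ring
  · refine Finset.sum_congr rfl fun j hj => ?_
    rw [← Finset.mul_prod_erase L _ hj]
    linear_combination (-(w x * ∏ l ∈ L.erase j, ε (x l))) * hε (x j)

lemma sum_mul_prod_of_exchangeable (hε : ∀ a, ε a * ε a = 1)
    (hsum : ∀ x ∈ Ω, ∑ j ∈ U, ε (x j) = c)
    (hΩ : ∀ i ∈ U, ∀ j ∈ U, ∀ x ∈ Ω, x ∘ Equiv.swap i j ∈ Ω)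
    (hw : ∀ i ∈ U, ∀ j ∈ U, ∀ x, w (x ∘ Equiv.swap i j) = w x)
    {K : Finset ι} (hK : K ⊆ U) :
    ∑ x ∈ Ω, w x * ∏ l ∈ K, ε (x l) =
      (∑ x ∈ Ω, w x) * normalizedKrawtchouk U.card c K.card := by
  obtain ⟨d, hd⟩ : ∃ d, K.card = d := ⟨_, rfl⟩
  rw [hd]
  induction d using Nat.twoStepInduction generalizing K with
  | zero => simp [Finset.card_eq_zero.1 hd]
  | one =>
    obtain ⟨i, rfl⟩ := Finset.card_eq_one.1 hd
    have hi : i ∈ U := Finset.singleton_subset_iff.1 hK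
    have hU : (U.card : ℝ) ≠ 0 := Nat.cast_ne_zero.2 (Finset.card_ne_zero_of_mem hi)
    have hrec := sum_mul_prod_insert_of_exchangeable hε hsum hΩ hw (Finset.empty_subset U) hi
      (Finset.notMem_empty i)
    simp only [Finset.card_empty, Nat.cast_zero, sub_zero, insert_empty_eq, Finset.prod_empty,
      mul_one, Finset.sum_empty] at hrec
    rw [normalizedKrawtchouk_one, mul_div_assoc', eq_div_iff hU]
    linarith
  | more d ih₀ ih₁ =>
    obtain ⟨i, L, hiL, rfl, hL⟩ := Finset.card_eq_succ.1 hd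
    obtain ⟨hi, hLU⟩ := Finset.insert_subset_iff.1 hK
    have hrec := sum_mul_prod_insert_of_exchangeable hε hsum hΩ hw hLU hi hiL
    have herase : ∀ j ∈ L, ∑ x ∈ Ω, w x * ∏ l ∈ L.erase j, ε (x l) =
        (∑ x ∈ Ω, w x) * normalizedKrawtchouk U.card c d := fun j hj =>
      ih₀ ((Finset.erase_subset j L).trans hLU) (by rw [Finset.card_erase_of_mem hj, hL]; rfl)
    rw [ih₁ hLU hL, Finset.sum_congr rfl herase, Finset.sum_const, hL, nsmul_eq_mul] at hrec
    have hcard : (d : ℝ) + 2 ≤ U.card := by exact_mod_cast hd ▸ Finset.card_le_card hK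
    rw [normalizedKrawtchouk_add_two, mul_div_assoc',
      eq_div_iff (by linarith : (U.card : ℝ) - (d + 1) ≠ 0)]
    push_cast at hrec
    linarith

lemma sum_perm_prod_eq [Fintype ι] {ε : ι → ℝ} (hε : ∀ i, ε i * ε i = 1) (K : Finset ι) :
    ∑ σ : Equiv.Perm ι, ∏ l ∈ K, ε (σ l) =
      Fintype.card (Equiv.Perm ι) * normalizedKrawtchouk (Fintype.card ι) (∑ i, ε i) K.card := by
  let Ω : Finset (ι → ι) := Finset.univ.map ⟨fun σ : Equiv.Perm ι => ⇑σ, DFunLike.coe_injective⟩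
  have hΩ : ∀ i j, ∀ x ∈ Ω, x ∘ Equiv.swap i j ∈ Ω := fun i j x hx => by
    obtain ⟨σ, -, rfl⟩ := Finset.mem_map.1 hx
    exact Finset.mem_map.2 ⟨(Equiv.swap i j).trans σ, Finset.mem_univ _, rfl⟩
  have h := sum_mul_prod_of_exchangeable (Ω := Ω) (w := fun _ => 1) (c := ∑ i, ε i) hε
    (by simp [Ω, Equiv.sum_comp]) (fun i _ j _ => hΩ i j) (fun _ _ _ _ _ => rfl)
    (Finset.subset_univ K)
  simpa [Ω] using h

end ExchangeableSigns

section CayleySpectrum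

open Matrix

variable {G : Type*} {S : Set G}

lemma addCayley_adj_iff [AddGroup G] (hneg : ∀ g ∈ S, -g ∈ S) (h0 : (0 : G) ∉ S) {x y : G} :
    (SimpleGraph.addCayley S).Adj x y ↔ -x + y ∈ S := by
  rw [SimpleGraph.addCayley_adj']
  constructor
  · rintro ⟨-, g, hg, rfl | rfl⟩
    · simpa using hg
    · simpa using hneg g hg
  · refine fun h => ⟨?_, -x + y, h, Or.inl (add_neg_cancel_left x y)⟩
    rintro rfl
    exact h0 (by simpa using h)

open Classical in
lemma adjMatrix_addCayley_mulVec [AddGroup G] [Fintype G] {R : Type*} [NonAssocSemiring R]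
    [hdec : DecidableRel (SimpleGraph.addCayley S).Adj] (hneg : ∀ g ∈ S, -g ∈ S)
    (h0 : (0 : G) ∉ S) (f : G → R) (x : G) :
    ((SimpleGraph.addCayley S).adjMatrix R *ᵥ f) x = ∑ g with g ∈ S, f (x + g) := by
  rw [SimpleGraph.adjMatrix_mulVec_apply]
  exact Finset.sum_nbij' (-x + ·) (x + ·)
    (fun y hy => by simpa [addCayley_adj_iff hneg h0] using hy)
    (fun g hg => by simpa [addCayley_adj_iff hneg h0] using hg)
    (by simp) (by simp) (by simp)

variable [AddCommGroup G] [Fintype G]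

lemma eq_zero_of_forall_addChar_dotProduct_eq_zero {f : G → ℂ}
    (h : ∀ ψ : AddChar G ℂ, ⇑ψ ⬝ᵥ f = 0) : f = 0 := by
  refine dotProduct_eq_zero_iff.1 fun g => ?_
  rw [dotProduct_comm, ← (AddChar.complexBasis G).sum_repr g, sum_dotProduct]
  simp [smul_dotProduct, h]

open Classical in
lemma adjMatrix_addCayley_mulVec_addChar [DecidableRel (SimpleGraph.addCayley S).Adj]
    (hneg : ∀ g ∈ S, -g ∈ S) (h0 : (0 : G) ∉ S) (ψ : AddChar G ℂ) :
    (SimpleGraph.addCayley S).adjMatrix ℂ *ᵥ ⇑ψ = (∑ g with g ∈ S, ψ g) • ⇑ψ := by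
  ext x
  simp only [adjMatrix_addCayley_mulVec hneg h0, AddChar.map_add_eq_mul, Pi.smul_apply,
    smul_eq_mul, mul_comm (ψ x), ← Finset.sum_mul]

open Classical in
lemma mem_graphEigenvalues_addCayley_iff_exists_ne_zero (hneg : ∀ g ∈ S, -g ∈ S)
    (h0 : (0 : G) ∉ S) {μ : ℝ} :
    μ ∈ graphEigenvalues (SimpleGraph.addCayley S) ↔
      ∃ f : G → ℝ, f ≠ 0 ∧ ∀ x, ∑ g with g ∈ S, f (x + g) = μ * f x := by
  constructor
  · intro hμ
    obtain ⟨f, hf⟩ := Module.End.HasEigenvalue.exists_hasEigenvector hμ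
    exact ⟨f, hf.2, fun x => (adjMatrix_addCayley_mulVec (hdec := _) hneg h0 f x).symm.trans
      (congrFun hf.apply_eq_smul x)⟩
  · rintro ⟨f, hf0, hf⟩
    refine Module.End.hasEigenvalue_of_hasEigenvector
      ⟨Module.End.mem_eigenspace_iff.2 (funext fun x => ?_), hf0⟩
    exact (adjMatrix_addCayley_mulVec (hdec := _) hneg h0 f x).trans (hf x)

open Classical in
lemma mem_graphEigenvalues_addCayley_iff (hneg : ∀ g ∈ S, -g ∈ S) (h0 : (0 : G) ∉ S) {μ : ℝ} :
    μ ∈ graphEigenvalues (SimpleGraph.addCayley S) ↔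
      ∃ ψ : AddChar G ℂ, ∑ g with g ∈ S, ψ g = μ := by
  rw [mem_graphEigenvalues_addCayley_iff_exists_ne_zero hneg h0]
  constructor
  · rintro ⟨f, hf0, hf⟩
    let F : G → ℂ := fun x => f x
    have hF : (SimpleGraph.addCayley S).adjMatrix ℂ *ᵥ F = (μ : ℂ) • F := by
      ext x
      rw [adjMatrix_addCayley_mulVec hneg h0]
      simpa [F] using congrArg Complex.ofReal (hf x)
    by_contra! hne
    refine hf0 (funext fun x => Complex.ofReal_injective ?_)
    refine congrFun (eq_zero_of_forall_addChar_dotProduct_eq_zero (f := F) fun ψ => ?_) x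
    have hself : (μ : ℂ) * (⇑ψ ⬝ᵥ F) = (∑ g with g ∈ S, ψ g) * (⇑ψ ⬝ᵥ F) := by
      rw [← smul_eq_mul, ← dotProduct_smul, ← hF, dotProduct_mulVec, ← mulVec_transpose,
        SimpleGraph.transpose_adjMatrix, adjMatrix_addCayley_mulVec_addChar hneg h0,
        smul_dotProduct, smul_eq_mul]
    exact (mul_eq_mul_right_iff.1 hself).resolve_left (hne ψ).symm
  · rintro ⟨ψ, hψ⟩
    refine ⟨fun x => (ψ x).re, fun h => by simpa using congrFun h 0, fun x => ?_⟩
    simp only [← Complex.re_ofReal_mul, ← hψ, Finset.sum_mul, Complex.re_sum,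
      AddChar.map_add_eq_mul, mul_comm (ψ x)]

/-- The additive character `x ↦ ζ_p ^ (v · x)` of `ℤ_p^ι`, where `ζ_p = exp(2πi/p)`. -/
noncomputable def dotProductAddChar {ι : Type*} [Fintype ι] {p : ℕ} [NeZero p] (v : ι → ZMod p) :
    AddChar (ι → ZMod p) ℂ :=
  ZMod.stdAddChar.compAddMonoidHom (dotProductBilin (ZMod p) (ZMod p) v).toAddMonoidHom

lemma surjective_dotProductAddChar {ι : Type*} [Fintype ι] {p : ℕ} [NeZero p] :
    Function.Surjective (dotProductAddChar : (ι → ZMod p) → AddChar (ι → ZMod p) ℂ) := by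
  classical
  refine ((Fintype.bijective_iff_injective_and_card _).2
    ⟨fun v w hvw => ?_, AddChar.card_eq.symm⟩).2
  exact dotProduct_eq v w fun x => ZMod.injective_stdAddChar (DFunLike.congr_fun hvw x)

end CayleySpectrum

section Types

open Classical in
lemma card_filter_card_fiber_eq_multinomial {ι κ : Type*} [Fintype ι] [Fintype κ] {t : κ → ℕ}
    (ht : ∑ k, t k = Fintype.card ι) :
    (Finset.univ.filter fun x : ι → κ => ∀ k, (Finset.univ.filter (x · = k)).card = t k).card =
      Nat.multinomial Finset.univ t := by
  let d : κ →₀ ℕ := Finsupp.equivFunOnFinite.symm t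
  have hcoeff := MvPolynomial.coeff_sum_X_pow_of_fintype (R := ℕ) d (Fintype.card ι)
  rw [if_pos ((Finsupp.sum_fintype _ _ fun _ => rfl).trans ht),
    Finsupp.multinomial_eq_of_support_subset (Finset.subset_univ _)] at hcoeff
  have hexpand : (∑ k, MvPolynomial.X k : MvPolynomial κ ℕ) ^ Fintype.card ι =
      ∑ x : ι → κ, MvPolynomial.monomial (∑ j, Finsupp.single (x j) 1) 1 := by
    rw [← Finset.card_univ, ← Finset.prod_const, Finset.prod_univ_sum, Fintype.piFinset_univ]
    exact Finset.sum_congr rfl fun x _ => (MvPolynomial.monomial_sum_one _ _).symm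
  have hfiber : ∀ x : ι → κ, (∑ j, Finsupp.single (x j) 1 : κ →₀ ℕ) = d ↔
      ∀ k, (Finset.univ.filter (x · = k)).card = t k := fun x => by
    simp [Finsupp.ext_iff, Finsupp.finsetSum_apply, Finsupp.single_apply, d]
  rw [hexpand, MvPolynomial.coeff_sum] at hcoeff
  simp only [MvPolynomial.coeff_monomial, hfiber, Finset.sum_boole, Nat.cast_id] at hcoeff
  exact hcoeff

variable {p n : ℕ} [NeZero p] {t : Fin p → ℕ}

open Classical in
/-- The vectors of type `t` as a finset, the index set of the sum defining `charSum`. -/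
noncomputable def typeFinset (p n : ℕ) [NeZero p] (t : Fin p → ℕ) : Finset (Fin n → ZMod p) :=
  Finset.univ.filter fun x => x ∈ vectorsOfType p n t

@[simp]
lemma mem_typeFinset {x : Fin n → ZMod p} : x ∈ typeFinset p n t ↔ x ∈ vectorsOfType p n t := by
  simp [typeFinset]

lemma charSum_eq_sum_typeFinset (t : Fin p → ℕ) (v : Fin n → ZMod p) :
    charSum p n t v = ∑ x ∈ typeFinset p n t, ZMod.stdAddChar (v ⬝ᵥ x) :=
  rfl

lemma comp_perm_mem_typeFinset {x : Fin n → ZMod p} (hx : x ∈ typeFinset p n t)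
    (σ : Equiv.Perm (Fin n)) : x ∘ σ ∈ typeFinset p n t := by
  rw [mem_typeFinset] at hx ⊢
  exact fun k => (Finset.card_equiv σ (by simp)).trans (hx k)

lemma charSum_comp_perm (t : Fin p → ℕ) (v : Fin n → ZMod p) (σ : Equiv.Perm (Fin n)) :
    charSum p n t (v ∘ σ) = charSum p n t v := by
  refine Finset.sum_nbij' (· ∘ σ.symm) (· ∘ σ) (fun x hx => comp_perm_mem_typeFinset hx _)
    (fun x hx => comp_perm_mem_typeFinset hx _) (fun x _ => ?_) (fun x _ => ?_) fun x _ => ?_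
  · simp [Function.comp_assoc]
  · simp [Function.comp_assoc]
  · simp only [dotProduct_comp_equiv_symm]

lemma sum_typeFinset_stdAddChar_sub_eq (t : Fin p → ℕ) {a b c : Fin n} (hb : a ≠ b)
    (hc : a ≠ c) :
    ∑ x ∈ typeFinset p n t, (ZMod.stdAddChar (x a - x b) : ℂ) =
      ∑ x ∈ typeFinset p n t, ZMod.stdAddChar (x a - x c) := by
  rw [← sum_comp_swap (i := b) (j := c) fun x hx => comp_perm_mem_typeFinset hx _]
  simp [Equiv.swap_apply_of_ne_of_ne hb hc]

variable (p) in
lemma bijective_natCast_fin : Function.Bijective fun k : Fin p => ((k : ℕ) : ZMod p) := by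
  refine ⟨fun k l hkl => ?_, fun a => ⟨⟨a.val, a.val_lt⟩, ZMod.natCast_zmod_val a⟩⟩
  have hval := congrArg ZMod.val hkl
  simpa only [ZMod.val_natCast_of_lt k.is_lt, ZMod.val_natCast_of_lt l.is_lt, Fin.val_inj]
    using hval

lemma sum_comp_of_mem_typeFinset {M : Type*} [AddCommMonoid M] {x : Fin n → ZMod p}
    (hx : x ∈ typeFinset p n t) (f : ZMod p → M) :
    ∑ j, f (x j) = ∑ k, t k • f ((k : ℕ) : ZMod p) := by
  have hfiber : ∑ j, f (x j) = ∑ k : ZMod p, hammingWt k x • f k := by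
    rw [← Finset.sum_fiberwise (s := Finset.univ) (g := x)]
    exact Finset.sum_congr rfl fun k _ => Finset.sum_eq_card_nsmul (by simp +contextual)
  rw [hfiber, ← (bijective_natCast_fin p).sum_comp fun k => hammingWt k x • f k]
  exact Finset.sum_congr rfl fun k _ => by rw [mem_typeFinset.1 hx k]

lemma card_typeFinset (ht : ∑ k, t k = n) :
    (typeFinset p n t).card = Nat.multinomial Finset.univ t := by
  classical
  rw [← card_filter_card_fiber_eq_multinomial (ht.trans (Fintype.card_fin n).symm)]
  let e : Fin p ≃ ZMod p := Equiv.ofBijective _ (bijective_natCast_fin p)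
  refine Finset.card_equiv ((Equiv.refl _).arrowCongr e.symm) fun x => ?_
  simp only [mem_typeFinset, vectorsOfType, hammingWt, Set.mem_ofPred_eq, Finset.mem_filter,
    Finset.mem_univ, true_and, Equiv.arrowCongr_apply, Equiv.refl_symm, Equiv.coe_refl,
    Function.comp_apply, id, Equiv.symm_apply_eq]
  rfl

lemma nonempty_vectorsOfType (ht : ∑ k, t k = n) : (vectorsOfType p n t).Nonempty := by
  have hpos : 0 < (typeFinset p n t).card := card_typeFinset ht ▸ Nat.multinomial_pos _ _
  obtain ⟨x, hx⟩ := Finset.card_pos.1 hpos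
  exact ⟨x, mem_typeFinset.1 hx⟩

lemma mem_graphEigenvalues_typeCayley_iff
    (hneg : ∀ x ∈ typeFinset p n t, -x ∈ typeFinset p n t) (h0 : 0 ∉ typeFinset p n t) {μ : ℝ} :
    μ ∈ graphEigenvalues (typeCayley p n t) ↔ ∃ v, charSum p n t v = μ := by
  rw [typeCayley, mem_graphEigenvalues_addCayley_iff (by simpa using hneg) (by simpa using h0)]
  exact surjective_dotProductAddChar.exists

end Types

section QuaternaryCharacters

open Matrix

variable {n : ℕ}

lemma stdAddChar_two : ZMod.stdAddChar (2 : ZMod 4) = -1 := by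
  have h := ZMod.stdAddChar_coe (N := 4) 2
  rw [Int.cast_ofNat] at h
  refine h.trans (Eq.trans ?_ Complex.exp_pi_mul_I)
  congr 1
  push_cast
  ring

/-- The sign `(-1) ^ b` of `a = 2 b + c ∈ ℤ_4`, where `b, c ∈ {0, 1}`. -/
def upperSign (a : ZMod 4) : ℝ :=
  if a = 2 ∨ a = 3 then -1 else 1

lemma upperSign_mul_self (a : ZMod 4) : upperSign a * upperSign a = 1 := by
  unfold upperSign
  split_ifs <;> norm_num

/-- The support modulo `2` of a vector of `ℤ_4^n`: the coordinates with an odd entry. -/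
def oddSet (x : Fin n → ZMod 4) : Finset (Fin n) :=
  Finset.univ.filter fun j => x j = 1 ∨ x j = 3

lemma mem_oddSet {x : Fin n → ZMod 4} {j : Fin n} : j ∈ oddSet x ↔ x j = 1 ∨ x j = 3 := by
  simp [oddSet]

/- Write `x = 2 b + c`; then `i ^ (v x) = i ^ (v c) * (-1) ^ (v b)`, and the second factor only
depends on the parity of `v`. -/
lemma stdAddChar_mul_eq (v x : ZMod 4) :
    ZMod.stdAddChar (v * x) = ZMod.stdAddChar (v * if x = 1 ∨ x = 3 then 1 else 0) *
      ((if v = 1 ∨ v = 3 then upperSign x else 1 : ℝ) : ℂ) := by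
  have hmul : ∀ v x : ZMod 4, v * x = (v * if x = 1 ∨ x = 3 then 1 else 0) +
      if v = 1 ∨ v = 3 then (if x = 2 ∨ x = 3 then 2 else 0) else 0 := by
    decide
  rw [hmul v x, AddChar.map_add_eq_mul, upperSign]
  congr 1
  split_ifs <;> simp [stdAddChar_two]

lemma stdAddChar_dotProduct_eq (v x : Fin n → ZMod 4) :
    ZMod.stdAddChar (v ⬝ᵥ x) =
      ZMod.stdAddChar (v ⬝ᵥ fun j => if j ∈ oddSet x then 1 else 0) *
        ((∏ j ∈ oddSet v, upperSign (x j) : ℝ) : ℂ) := by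
  have hprod : ∀ y : Fin n → ZMod 4,
      ZMod.stdAddChar (v ⬝ᵥ y) = ∏ j, ZMod.stdAddChar (v j * y j) := fun y =>
    map_prod ZMod.stdAddChar.toMonoidHom (fun j => Multiplicative.ofAdd (v j * y j)) Finset.univ
  rw [hprod, hprod, oddSet.eq_1 v, Finset.prod_filter, Complex.ofReal_prod,
    ← Finset.prod_mul_distrib]
  exact Finset.prod_congr rfl fun j _ => by simp only [mem_oddSet, ← stdAddChar_mul_eq]

lemma oddSet_add_one (v : Fin n → ZMod 4) : oddSet (v + fun _ => 1) = (oddSet v)ᶜ := by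
  have hone : ∀ a : ZMod 4, a + 1 = 1 ∨ a + 1 = 3 ↔ ¬(a = 1 ∨ a = 3) := by decide
  ext j
  simp only [Finset.mem_compl, mem_oddSet, Pi.add_apply, hone]

variable {t : Fin 4 → ℕ}

lemma sum_comp_of_mem_typeFinset_four {M : Type*} [AddCommMonoid M] {x : Fin n → ZMod 4}
    (hx : x ∈ typeFinset 4 n t) (f : ZMod 4 → M) :
    ∑ j, f (x j) = t 0 • f 0 + t 1 • f 1 + t 2 • f 2 + t 3 • f 3 :=
  (sum_comp_of_mem_typeFinset hx f).trans (Fin.sum_univ_four _)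

lemma card_oddSet {x : Fin n → ZMod 4} (hx : x ∈ typeFinset 4 n t) :
    (oddSet x).card = t 1 + t 3 := by
  rw [oddSet, Finset.card_filter,
    sum_comp_of_mem_typeFinset_four hx fun a => if a = 1 ∨ a = 3 then 1 else 0]
  change t 0 • 0 + t 1 • 1 + t 2 • 0 + t 3 • 1 = t 1 + t 3
  simp

/- Averaging over the permutations of `v` exchanges the roles of `v` and `x`, so that the degree of
the Krawtchouk value is the number of odd entries of `x`. -/
lemma charSum_of_oddSet_eq_empty (t : Fin 4 → ℕ) {v : Fin n → ZMod 4} (hv : oddSet v = ∅) :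
    charSum 4 n t v = ((typeFinset 4 n t).card *
      normalizedKrawtchouk n (∑ i, upperSign (v i)) (t 1 + t 3) : ℝ) := by
  set κ := normalizedKrawtchouk n (∑ i, upperSign (v i)) (t 1 + t 3)
  let P : ℝ := Fintype.card (Equiv.Perm (Fin n))
  have hP : (P : ℂ) ≠ 0 := by simp [P]
  have hterm : ∀ x, ∀ σ : Equiv.Perm (Fin n), (ZMod.stdAddChar ((v ∘ σ) ⬝ᵥ x) : ℂ) =
      (∏ j ∈ oddSet x, upperSign (v (σ j)) : ℝ) := fun x σ => by
    have hodd : ∀ j, ¬(v j = 1 ∨ v j = 3) := fun j hj => by simpa [hv] using mem_oddSet.2 hj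
    have hdot : (x ⬝ᵥ fun j => if j ∈ oddSet (v ∘ σ) then 1 else 0) = 0 := by
      simp [dotProduct, mem_oddSet, hodd]
    rw [dotProduct_comm, stdAddChar_dotProduct_eq, hdot, AddChar.map_zero_eq_one, one_mul]
    rfl
  have hsum : ∀ x ∈ typeFinset 4 n t,
      ∑ σ : Equiv.Perm (Fin n), ZMod.stdAddChar ((v ∘ σ) ⬝ᵥ x) = ((P * κ : ℝ) : ℂ) :=
    fun x hx => by
      rw [Finset.sum_congr rfl fun σ _ => hterm x σ, ← Complex.ofReal_sum,
        sum_perm_prod_eq (ε := fun i => upperSign (v i)) (fun i => upperSign_mul_self _),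
        card_oddSet hx, Fintype.card_fin]
  refine mul_left_cancel₀ hP ?_
  calc (P : ℂ) * charSum 4 n t v = ∑ σ : Equiv.Perm (Fin n), charSum 4 n t (v ∘ σ) := by
        simp [charSum_comp_perm, P]
    _ = ∑ x ∈ typeFinset 4 n t, ∑ σ : Equiv.Perm (Fin n), ZMod.stdAddChar ((v ∘ σ) ⬝ᵥ x) :=
        Finset.sum_comm
    _ = P * ((typeFinset 4 n t).card * κ : ℝ) := by
        rw [Finset.sum_congr rfl hsum, Finset.sum_const, nsmul_eq_mul]
        push_cast
        ring

end QuaternaryCharacters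

section BalancedType

open Matrix

variable {n r s : ℕ}

/-- The connection set of `G(r, s)`: the vectors of `ℤ_4^n` of type `(r, s, r, s)`. -/
noncomputable abbrev balancedFinset (n r s : ℕ) : Finset (Fin n → ZMod 4) :=
  typeFinset 4 n ![r, s, r, s]

lemma sum_comp_of_mem_balancedFinset {M : Type*} [AddCommMonoid M] {x : Fin n → ZMod 4}
    (hx : x ∈ balancedFinset n r s) (f : ZMod 4 → M) :
    ∑ j, f (x j) = r • (f 0 + f 2) + s • (f 1 + f 3) := by
  rw [sum_comp_of_mem_typeFinset_four hx]
  change r • f 0 + s • f 1 + r • f 2 + s • f 3 = _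
  rw [smul_add, smul_add]
  abel

lemma neg_mem_balancedFinset {x : Fin n → ZMod 4} (hx : x ∈ balancedFinset n r s) :
    -x ∈ balancedFinset n r s := by
  have hneg : ∀ k : ZMod 4, hammingWt k (-x) = hammingWt (-k) x := fun k => by
    simp [hammingWt, neg_eq_iff_eq_neg]
  rw [mem_typeFinset] at hx ⊢
  intro k
  rw [hneg]
  fin_cases k
  exacts [hx 0, hx 3, hx 2, hx 1]

lemma zero_notMem_balancedFinset (hs : 1 ≤ s) : 0 ∉ balancedFinset n r s := fun h => by
  have hcard : (oddSet (0 : Fin n → ZMod 4)).card = s + s := card_oddSet h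
  have hempty : oddSet (0 : Fin n → ZMod 4) = ∅ :=
    Finset.filter_eq_empty_iff.2 fun j _ => by simp only [Pi.zero_apply]; decide
  rw [hempty, Finset.card_empty] at hcard
  omega

lemma dotProduct_const_of_mem_balancedFinset (hr : Even r) {x : Fin n → ZMod 4}
    (hx : x ∈ balancedFinset n r s) (c : ZMod 4) : (fun _ => c) ⬝ᵥ x = 0 := by
  obtain ⟨k, rfl⟩ := hr
  rw [dotProduct, sum_comp_of_mem_balancedFinset hx fun a => c * a]
  have h4 : (4 : ZMod 4) = 0 := rfl
  simp only [nsmul_eq_mul]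
  push_cast
  linear_combination (k + s : ZMod 4) * c * h4

lemma charSum_add_const (hr : Even r) (v : Fin n → ZMod 4) (c : ZMod 4) :
    charSum 4 n ![r, s, r, s] (v + fun _ => c) = charSum 4 n ![r, s, r, s] v := by
  rw [charSum_eq_sum_typeFinset, charSum_eq_sum_typeFinset]
  refine Finset.sum_congr rfl fun x hx => ?_
  rw [add_dotProduct, dotProduct_const_of_mem_balancedFinset hr hx, add_zero]

lemma sum_stdAddChar_sub_of_mem_balancedFinset {x : Fin n → ZMod 4}
    (hx : x ∈ balancedFinset n r s) (c : ZMod 4) :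
    ∑ b, (ZMod.stdAddChar (c - x b) : ℂ) = 0 := by
  have htwo : ∀ a : ZMod 4, (ZMod.stdAddChar (a + 2) : ℂ) = -ZMod.stdAddChar a := fun a => by
    rw [AddChar.map_add_eq_mul, stdAddChar_two, mul_neg_one]
  have h0 : c - 0 = (c - 2) + 2 := by ring
  have h1 : c - 1 = (c - 3) + 2 := by ring
  rw [sum_comp_of_mem_balancedFinset hx fun a => (ZMod.stdAddChar (c - a) : ℂ), h0, h1, htwo, htwo]
  simp

/- By symmetry `λ(e_a - e_b)` does not depend on `b ≠ a`, and for each `x` the sum over all `b`,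
including `b = a`, of `i ^ (x_a - x_b)` is zero. -/
lemma charSum_single_sub_single {a b : Fin n} (hab : a ≠ b) :
    charSum 4 n ![r, s, r, s] (Pi.single a 1 - Pi.single b 1) =
      (-((balancedFinset n r s).card : ℝ) / ((n : ℝ) - 1) : ℝ) := by
  have hval : charSum 4 n ![r, s, r, s] (Pi.single a 1 - Pi.single b 1) =
      ∑ x ∈ balancedFinset n r s, ZMod.stdAddChar (x a - x b) := by
    simp [charSum_eq_sum_typeFinset, sub_dotProduct]
  have htotal : ∑ b', ∑ x ∈ balancedFinset n r s, (ZMod.stdAddChar (x a - x b') : ℂ) = 0 := by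
    rw [Finset.sum_comm]
    exact Finset.sum_eq_zero fun x hx => sum_stdAddChar_sub_of_mem_balancedFinset hx (x a)
  have hothers : ∑ b' ∈ Finset.univ.erase a,
      ∑ x ∈ balancedFinset n r s, (ZMod.stdAddChar (x a - x b') : ℂ) =
        (n - 1) * ∑ x ∈ balancedFinset n r s, ZMod.stdAddChar (x a - x b) := by
    rw [Finset.sum_congr rfl fun b' hb' => sum_typeFinset_stdAddChar_sub_eq _
      (Finset.ne_of_mem_erase hb').symm hab,
      Finset.sum_const, Finset.card_erase_of_mem (Finset.mem_univ a), Finset.card_fin,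
      nsmul_eq_mul, Nat.cast_pred a.pos]
  rw [← Finset.add_sum_erase _ _ (Finset.mem_univ a), hothers, ← hval] at htotal
  simp only [sub_self, AddChar.map_zero_eq_one, Finset.sum_const, nsmul_eq_mul, mul_one] at htotal
  have hn : (n : ℂ) - 1 ≠ 0 := by
    have h2n : 2 ≤ n := by omega
    rw [← Nat.cast_pred a.pos]
    exact_mod_cast (by omega : n - 1 ≠ 0)
  push_cast
  rw [eq_div_iff hn]
  linear_combination htotal

/-- The balanced vectors with odd set `D`. -/
noncomputable def balancedFiber (n r s : ℕ) (D : Finset (Fin n)) : Finset (Fin n → ZMod 4) :=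
  (balancedFinset n r s).filter fun x => oddSet x = D

variable {D : Finset (Fin n)}

lemma comp_swap_mem_balancedFiber {x : Fin n → ZMod 4} (hx : x ∈ balancedFiber n r s D)
    {i j : Fin n} (hij : i ∈ D ↔ j ∈ D) : x ∘ Equiv.swap i j ∈ balancedFiber n r s D := by
  obtain ⟨hbal, rfl⟩ := Finset.mem_filter.1 hx
  refine Finset.mem_filter.2 ⟨comp_perm_mem_typeFinset hbal _, Finset.ext fun l => ?_⟩
  rw [mem_oddSet, Function.comp_apply, ← mem_oddSet]
  rcases eq_or_ne l i with rfl | hi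
  · simpa using hij.symm
  rcases eq_or_ne l j with rfl | hj
  · simpa using hij
  rw [Equiv.swap_apply_of_ne_of_ne hi hj]

lemma sum_upperSign_eq_zero {x : Fin n → ZMod 4} (hx : x ∈ balancedFinset n r s) :
    ∑ j, upperSign (x j) = 0 := by
  rw [sum_comp_of_mem_balancedFinset hx]
  change r • ((1 : ℝ) + -1) + s • ((1 : ℝ) + -1) = 0
  simp

lemma sum_oddSet_upperSign_eq_zero {x : Fin n → ZMod 4} (hx : x ∈ balancedFinset n r s) :
    ∑ j ∈ oddSet x, upperSign (x j) = 0 := by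
  rw [oddSet, Finset.sum_filter,
    sum_comp_of_mem_balancedFinset hx fun a => if a = 1 ∨ a = 3 then upperSign a else 0]
  change r • ((0 : ℝ) + 0) + s • ((1 : ℝ) + -1) = 0
  simp

lemma sum_compl_oddSet_upperSign_eq_zero {x : Fin n → ZMod 4} (hx : x ∈ balancedFinset n r s) :
    ∑ j ∈ (oddSet x)ᶜ, upperSign (x j) = 0 := by
  have h := Finset.sum_add_sum_compl (oddSet x) fun j => upperSign (x j)
  rwa [sum_oddSet_upperSign_eq_zero hx, sum_upperSign_eq_zero hx, zero_add] at h

lemma sum_prod_upperSign (K : Finset (Fin n)) :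
    ∑ x ∈ balancedFinset n r s, ∏ j ∈ K, upperSign (x j) =
      (balancedFinset n r s).card * normalizedKrawtchouk n 0 K.card := by
  simpa using sum_mul_prod_of_exchangeable (w := fun _ => 1) upperSign_mul_self
    (fun x hx => sum_upperSign_eq_zero hx)
    (fun i _ j _ x hx => comp_perm_mem_typeFinset hx (Equiv.swap i j)) (fun _ _ _ _ _ => rfl)
    (Finset.subset_univ K)

lemma sum_balancedFiber_prod_upperSign (D K : Finset (Fin n)) :
    ∑ x ∈ balancedFiber n r s D, ∏ j ∈ K, upperSign (x j) =
      (balancedFiber n r s D).card *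
        (normalizedKrawtchouk Dᶜ.card 0 (K \ D).card *
          normalizedKrawtchouk D.card 0 (K ∩ D).card) := by
  have hodd : ∀ x ∈ balancedFiber n r s D, ∑ j ∈ D, upperSign (x j) = 0 := fun x hx => by
    obtain ⟨hbal, rfl⟩ := Finset.mem_filter.1 hx
    exact sum_oddSet_upperSign_eq_zero hbal
  have heven : ∀ x ∈ balancedFiber n r s D, ∑ j ∈ Dᶜ, upperSign (x j) = 0 := fun x hx => by
    obtain ⟨hbal, rfl⟩ := Finset.mem_filter.1 hx
    exact sum_compl_oddSet_upperSign_eq_zero hbal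
  have hinner : ∑ x ∈ balancedFiber n r s D, ∏ j ∈ K \ D, upperSign (x j) =
      (balancedFiber n r s D).card * normalizedKrawtchouk Dᶜ.card 0 (K \ D).card := by
    simpa using sum_mul_prod_of_exchangeable (w := fun _ => 1) upperSign_mul_self heven
      (fun i hi j hj x hx => comp_swap_mem_balancedFiber hx
        (iff_of_false (Finset.mem_compl.1 hi) (Finset.mem_compl.1 hj)))
      (fun _ _ _ _ _ => rfl) (fun l hl => Finset.mem_compl.2 (Finset.mem_sdiff.1 hl).2)
  have hinvariant : ∀ i ∈ D, ∀ j ∈ D, ∀ x : Fin n → ZMod 4,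
      ∏ l ∈ K \ D, upperSign ((x ∘ Equiv.swap i j) l) = ∏ l ∈ K \ D, upperSign (x l) :=
    fun i hi j hj x => Finset.prod_congr rfl fun l hl => by
      have hlD := (Finset.mem_sdiff.1 hl).2
      rw [Function.comp_apply, Equiv.swap_apply_of_ne_of_ne (ne_of_mem_of_not_mem hi hlD).symm
        (ne_of_mem_of_not_mem hj hlD).symm]
  rw [← mul_assoc, ← hinner, ← sum_mul_prod_of_exchangeable upperSign_mul_self hodd
    (fun i hi j hj x hx => comp_swap_mem_balancedFiber hx (iff_of_true hi hj)) hinvariant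
    Finset.inter_subset_right]
  exact Finset.sum_congr rfl fun x _ => by rw [mul_comm, Finset.prod_inter_mul_prod_sdiff]

lemma neg_one_pow_mul_sum_balancedFiber_nonneg (D K : Finset (Fin n)) :
    0 ≤ (-1) ^ (K.card / 2) * ∑ x ∈ balancedFiber n r s D, ∏ j ∈ K, upperSign (x j) := by
  rw [sum_balancedFiber_prod_upperSign, mul_left_comm, ← Finset.card_sdiff_add_card_inter K D]
  refine mul_nonneg (Nat.cast_nonneg _)
    (neg_one_pow_div_two_mul_normalizedKrawtchouk_at_zero_mul_nonneg ?_ ?_)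
  · exact_mod_cast Finset.card_le_card fun l hl => Finset.mem_compl.2 (Finset.mem_sdiff.1 hl).2
  · exact_mod_cast Finset.card_le_card Finset.inter_subset_right

lemma charSum_eq_sum_balancedFiber (v : Fin n → ZMod 4) :
    charSum 4 n ![r, s, r, s] v = ∑ D : Finset (Fin n),
      ZMod.stdAddChar (v ⬝ᵥ fun j => if j ∈ D then 1 else 0) *
        ((∑ x ∈ balancedFiber n r s D, ∏ j ∈ oddSet v, upperSign (x j) : ℝ) : ℂ) := by
  rw [charSum_eq_sum_typeFinset, ← Finset.sum_fiberwise _ oddSet]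
  refine Finset.sum_congr rfl fun D _ => ?_
  rw [Complex.ofReal_sum, Finset.mul_sum]
  refine Finset.sum_congr rfl fun x hx => ?_
  rw [stdAddChar_dotProduct_eq, (Finset.mem_filter.1 hx).2]

/- The contributions of the odd sets `D` all have the sign `(-1) ^ (|oddSet v| / 2)`, so the
triangle inequality loses nothing but the unimodular factors. -/
lemma norm_charSum_le (v : Fin n → ZMod 4) :
    ‖charSum 4 n ![r, s, r, s] v‖ ≤
      (balancedFinset n r s).card * |normalizedKrawtchouk n 0 (oddSet v).card| := by
  set K := oddSet v
  let B : Finset (Fin n) → ℝ := fun D => ∑ x ∈ balancedFiber n r s D, ∏ j ∈ K, upperSign (x j)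
  have habs : ∀ D, |B D| = (-1) ^ (K.card / 2) * B D := fun D => by
    rw [← abs_of_nonneg (neg_one_pow_mul_sum_balancedFiber_nonneg D K), abs_mul, abs_neg_one_pow,
      one_mul]
  calc ‖charSum 4 n ![r, s, r, s] v‖ ≤ ∑ D, |B D| := by
        rw [charSum_eq_sum_balancedFiber]
        refine (norm_sum_le _ _).trans_eq (Finset.sum_congr rfl fun D _ => ?_)
        rw [norm_mul, AddChar.norm_apply, one_mul, Complex.norm_real, Real.norm_eq_abs]
    _ = (-1) ^ (K.card / 2) * ∑ D, B D := by simp only [habs, Finset.mul_sum]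
    _ = (-1) ^ (K.card / 2) *
          ((balancedFinset n r s).card * normalizedKrawtchouk n 0 K.card) := by
        rw [← sum_prod_upperSign, ← Finset.sum_fiberwise _ oddSet]
        rfl
    _ ≤ _ := by
        refine (le_abs_self _).trans_eq ?_
        rw [abs_mul, abs_neg_one_pow, one_mul, abs_mul, Nat.abs_cast]

end BalancedType

section MinimalEigenvalue

variable {n r s : ℕ}

lemma neg_card_div_le_charSum_re (hr : Even r)
    (hκ : ∀ z : ℝ, -(1 / ((n : ℝ) - 1)) ≤ normalizedKrawtchouk n z (2 * s)) (v : Fin n → ZMod 4) :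
    -((balancedFinset n r s).card : ℝ) / ((n : ℝ) - 1) ≤ (charSum 4 n ![r, s, r, s] v).re := by
  wlog hle : 2 * (oddSet v).card ≤ n generalizing v
  · rw [← charSum_add_const hr v 1]
    refine this _ ?_
    rw [oddSet_add_one, Finset.card_compl, Fintype.card_fin]
    omega
  rw [neg_div, ← mul_one_div, ← mul_neg]
  rcases (oddSet v).eq_empty_or_nonempty with hempty | hne
  · rw [charSum_of_oddSet_eq_empty _ hempty, Complex.ofReal_re]
    refine mul_le_mul_of_nonneg_left ?_ (Nat.cast_nonneg _)
    exact (hκ _).trans_eq (congrArg _ (two_mul s))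
  · rw [mul_neg]
    refine neg_le_of_abs_le ((Complex.abs_re_le_norm _).trans ((norm_charSum_le v).trans ?_))
    refine mul_le_mul_of_nonneg_left ?_ (Nat.cast_nonneg _)
    exact abs_normalizedKrawtchouk_at_zero_le_of_two_mul_le hne.card_pos (by exact_mod_cast hle)

lemma exists_eq_single_sub_single_add_two {v : Fin n → ZMod 4}
    (hv : v ∈ vectorsOfType 4 n ![0, 1, n - 2, 1]) :
    ∃ a b : Fin n, a ≠ b ∧ v = (Pi.single a 1 - Pi.single b 1) + fun _ => 2 := by
  have hcases : ∀ a : ZMod 4, a = 0 ∨ a = 1 ∨ a = 2 ∨ a = 3 := by decide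
  have h0 : ∀ j, v j ≠ 0 := fun j => by
    simpa using Finset.filter_eq_empty_iff.1 (Finset.card_eq_zero.1 (hv 0)) (Finset.mem_univ j)
  obtain ⟨b, hb⟩ := Finset.card_eq_one.1 (hv 1)
  obtain ⟨a, ha⟩ := Finset.card_eq_one.1 (hv 3)
  have h1 : ∀ j, v j = 1 ↔ j = b := fun j => by simpa using Finset.ext_iff.1 hb j
  have h3 : ∀ j, v j = 3 ↔ j = a := fun j => by simpa using Finset.ext_iff.1 ha j
  have hab : a ≠ b := fun hab =>
    absurd (((h3 a).2 rfl).symm.trans ((h1 a).2 hab)) (by decide)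
  refine ⟨a, b, hab, funext fun j => ?_⟩
  rcases hcases (v j) with hj | hj | hj | hj
  · exact absurd hj (h0 j)
  · obtain rfl := (h1 j).1 hj
    simpa [hj, hab.symm] using (by decide : (1 : ZMod 4) = -1 + 2)
  · have hja : j ≠ a := fun h => absurd (hj.symm.trans ((h3 j).2 h)) (by decide)
    have hjb : j ≠ b := fun h => absurd (hj.symm.trans ((h1 j).2 h)) (by decide)
    simp [hj, hja, hjb]
  · obtain rfl := (h3 j).1 hj
    simpa [hj, hab] using (by decide : (3 : ZMod 4) = 1 + 2)

lemma charSum_of_mem_vectorsOfType_zero_one_one (hr : Even r) {v : Fin n → ZMod 4}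
    (hv : v ∈ vectorsOfType 4 n ![0, 1, n - 2, 1]) :
    charSum 4 n ![r, s, r, s] v = (-((balancedFinset n r s).card : ℝ) / ((n : ℝ) - 1) : ℝ) := by
  obtain ⟨a, b, hab, rfl⟩ := exists_eq_single_sub_single_add_two hv
  rw [charSum_add_const hr, charSum_single_sub_single hab]

lemma card_balancedFinset (hn : n = 2 * (r + s)) :
    (balancedFinset n r s).card = Nat.multinomial Finset.univ ![r, s, r, s] :=
  card_typeFinset (by rw [Fin.sum_univ_four]; change r + s + r + s = n; omega)

lemma nonempty_vectorsOfType_zero_one_one (hn : 2 ≤ n) :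
    (vectorsOfType 4 n ![0, 1, n - 2, 1]).Nonempty :=
  nonempty_vectorsOfType (by rw [Fin.sum_univ_four]; change 0 + 1 + (n - 2) + 1 = n; omega)

lemma isLeast_graphEigenvalues_typeCayley (hn : 2 ≤ n) (hs : 1 ≤ s) (hr : Even r)
    (hκ : ∀ z : ℝ, -(1 / ((n : ℝ) - 1)) ≤ normalizedKrawtchouk n z (2 * s)) :
    IsLeast (graphEigenvalues (typeCayley 4 n ![r, s, r, s]))
      (-((balancedFinset n r s).card : ℝ) / ((n : ℝ) - 1)) := by
  have hspec {μ : ℝ} := mem_graphEigenvalues_typeCayley_iff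
    (fun x hx => neg_mem_balancedFinset (n := n) (r := r) hx) (zero_notMem_balancedFinset hs)
    (μ := μ)
  obtain ⟨v, hv⟩ := nonempty_vectorsOfType_zero_one_one hn
  refine ⟨hspec.2 ⟨v, charSum_of_mem_vectorsOfType_zero_one_one hr hv⟩, fun μ hμ => ?_⟩
  obtain ⟨w, hw⟩ := hspec.1 hμ
  simpa only [hw, Complex.ofReal_re] using neg_card_div_le_charSum_re hr hκ w

end MinimalEigenvalue

theorem mainTheorem1_general :
    ∀ᶠ n : ℕ in Filter.atTop, ∀ r s : ℕ, n = 2 * (r + s) → Even r → 2 ≤ s →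
      2 * s ≤ (0.17 : ℝ) * n →
      IsLeast (graphEigenvalues (typeCayley 4 n ![r, s, r, s]))
        (-(Nat.multinomial Finset.univ ![r, s, r, s] : ℝ) / ((n : ℝ) - 1)) ∧
      (vectorsOfType 4 n ![0, 1, n - 2, 1]).Nonempty ∧
      ∀ v ∈ vectorsOfType 4 n ![0, 1, n - 2, 1],
        charSum 4 n ![r, s, r, s] v =
          ((-(Nat.multinomial Finset.univ ![r, s, r, s] : ℝ) / ((n : ℝ) - 1) : ℝ) : ℂ) := by
  filter_upwards [eventually_neg_le_normalizedKrawtchouk_two_mul] with n hκ r s hn hr hs hsn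
  rw [← card_balancedFinset hn]
  exact ⟨isLeast_graphEigenvalues_typeCayley (by omega) (by omega) hr (hκ s hs hsn),
    nonempty_vectorsOfType_zero_one_one (by omega),
    fun v hv => charSum_of_mem_vectorsOfType_zero_one_one hr hv⟩

theorem mainTheorem1 :
    -- (R1): `s ≥ 2` fixed and `n` large enough
    (∀ s : ℕ, 2 ≤ s → ∃ N : ℕ, ∀ n r : ℕ, n = 2 * (r + s) → s ≤ r → Even r → N ≤ n →
      IsLeast (graphEigenvalues (typeCayley 4 n ![r, s, r, s]))
        (-(Nat.multinomial Finset.univ ![r, s, r, s] : ℝ) / ((n : ℝ) - 1)) ∧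
      (vectorsOfType 4 n ![0, 1, n - 2, 1]).Nonempty ∧
      ∀ v ∈ vectorsOfType 4 n ![0, 1, n - 2, 1],
        charSum 4 n ![r, s, r, s] v =
          ((-(Nat.multinomial Finset.univ ![r, s, r, s] : ℝ) / ((n : ℝ) - 1) : ℝ) : ℂ)) ∧
    -- (R2): `s = α n / 2` with `0 < α ≤ 0.17` fixed and `n` large enough
    (∀ α : ℝ, 0 < α → α ≤ 0.17 → ∃ N : ℕ, ∀ n r s : ℕ, n = 2 * (r + s) → s ≤ r → Even r →
      (s : ℝ) = α * ((n : ℝ) / 2) → N ≤ n →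
      IsLeast (graphEigenvalues (typeCayley 4 n ![r, s, r, s]))
        (-(Nat.multinomial Finset.univ ![r, s, r, s] : ℝ) / ((n : ℝ) - 1)) ∧
      (vectorsOfType 4 n ![0, 1, n - 2, 1]).Nonempty ∧
      ∀ v ∈ vectorsOfType 4 n ![0, 1, n - 2, 1],
        charSum 4 n ![r, s, r, s] v =
          ((-(Nat.multinomial Finset.univ ![r, s, r, s] : ℝ) / ((n : ℝ) - 1) : ℝ) : ℂ)) := by
  obtain ⟨N, hN⟩ := Filter.eventually_atTop.1 mainTheorem1_general
  refine ⟨fun s hs => ?_, fun α hα hα' => ?_⟩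
  · refine ⟨max N (12 * s), fun n r hn _ hr hNn => ?_⟩
    have hsn : 12 * (s : ℝ) ≤ n := by exact_mod_cast (le_max_right _ _).trans hNn
    exact hN n ((le_max_left _ _).trans hNn) r s hn hr hs (by linarith)
  · refine ⟨max N ⌈4 / α⌉₊, fun n r s hn _ hr hsα hNn => ?_⟩
    have hαn : 4 ≤ n * α :=
      (div_le_iff₀ hα).1 (Nat.ceil_le.1 ((le_max_right _ _).trans hNn))
    have hs : (2 : ℝ) ≤ s := by linarith
    have hsn : α * n ≤ 0.17 * n := mul_le_mul_of_nonneg_right hα' n.cast_nonneg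
    exact hN n ((le_max_left _ _).trans hNn) r s hn hr (by exact_mod_cast hs) (by linarith)
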